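/- Consider the Lucas exchange economy with $k$ assets: dividends $z=(z_1,\dots,z_k)^\top$ lie in a Borel set $Z\subseteq\mathbb{R}^k_+$ and form a Markov process with stationary transition function $Q$ on $Z$; $\beta\in(0,1)$. Given a price function $p:Z\to\mathbb{R}^k_+$, initial holdings $x_0$ and initial state $z_0$, the consumer chooses measurable history-dependent consumption $c_t=c_t(z_0,\dots,z_t)\ge 0$ and holdings $x_{t+1}=x_{t+1}(z_0,\dots,z_t)\ge 0$ to maximize $\mathrm{E}\sum_{t\ge 0}\beta^t u(c_t)$ subject to $c_t+x_{t+1}^\top p(z_t)\le x_t^\top(z_t+p(z_t))$ for all histories starting at $z_0$ and all $t$. An equilibrium price is a continuous $p:Z\to\mathbb{R}^k_+$ such that, for every $z_0\in Z$ and with $x_0=\mathbf 1=(1,\dots,1)^\top$, the plan $x_{t+1}=\mathbf 1$, $c_t=\mathbf 1^\top z_t$ is optimal, with finite value. Assume that $u:[0,\infty)\to\mathbb{R}$ satisfies $u(0)=0$, is continuously differentiable (one-sidedly at $0$) with $u'(c)>0$ for all $c\ge 0$, and is strictly concave; that there are $\gamma,\delta\ge 0$ with $c\,u'(c)\le\gamma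 c+\delta$ for all $c\ge 0$; and that there is $a>0$ with $u'(\mathbf 1^\top z)\ge a$ for all $z\in Z$. Assume moreover one of the following. (M1) $z_{t+1}=Bz_t+w_t$, where $B$ is a $k\times k$ matrix with nonnegative entries whose operator norm with respect to some norm on $\mathbb{R}^k$ is less than one, and the $w_t$ are i.i.d. random vectors with values in $\mathbb{R}^k_+$ and finite expectation. (M2) $z_{i,t+1}=z_{i,t}^{\rho_i}w_{i,t+1}$ for $i=1,\dots,k$ (with $0^0=1$), where $0\le\rho_i\le 1$, the $w_t$ are i.i.d. random vectors with values in $[1,\infty)^k$ and finite expectation, and $\mathrm{E}w_i<1/\beta$ for every $i$ with $\rho_i=1$. Then there are functions $\phi_1,\dots,\phi_k:Z\to\mathbb{R}$, integrable with respect to $Q(z,\cdot)$ for every $z\in Z$, that solve $$\phi_i(z)=h_i(z)+\beta\int_Z\phi_i(z')\,Q(z,dz'),\qquad h_i(z)=\beta\int_Z z_i'\,u'(\mathbf 1^\top z')\,Q(z,dz'),$$ for all $z\in Z$ and all $i$ (the integrals defining the $h_i$ being finite), and such that $p=(p_1,\dots,p_k)^\top$ with $p_i(z)=\phi_i(z)/u'(\mathbf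 1^\top z)$ is an equilibrium price. Moreover there are vectors $a_i\in\mathbb{R}^k_+$ and scalars $b_i>0$ with $p_i(z)\le a_i^\top z+b_i$ for all $z\in Z$ and $i=1,\dots,k$. -/

import Mathlib

open Set MeasureTheory ProbabilityTheory
open scoped ENNReal

/-! ### The Lucas exchange economy

Dividend vectors live in a set `Z ⊆ ℝᵏ`, a history `z^t = (z_0, …, z_t)` is a function
`Finset.Iic t → Z`, and `Q` is the transition function of the dividend process. -/

namespace Lucas

noncomputable section

variable {k : ℕ} {Z : Set (Fin k → ℝ)}

/-- The aggregate dividend `𝟏ᵀ z`. -/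
def total (z : Fin k → ℝ) : ℝ := ∑ i, z i

/-- Marginal utility on `[0, ∞)`; at `0` this is the right derivative. -/
def marginal (u : ℝ → ℝ) (c : ℝ) : ℝ := derivWithin u (Ici 0) c

/-- The law of the whole dividend path `(z_0, z_1, …)` of the Markov chain with transition
function `Q` started at `z₀` (Ionescu-Tulcea). -/
def pathLaw (Q : Kernel Z Z) [IsMarkovKernel Q] (z₀ : Z) : Measure (ℕ → Z) :=
  Kernel.traj (X := fun _ => Z)
    (fun n => Q.comap (fun h : Finset.Iic n → Z => h ⟨n, Finset.mem_Iic.2 le_rfl⟩)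
      (measurable_pi_apply _)) 0 (fun _ => z₀)

/-- Contingent plans: `cons t z^t` is the consumption `c_t` and `hold t z^t` is the vector
`x_{t+1}` of asset holdings chosen at the end of period `t`. -/
structure Plan (Z : Set (Fin k → ℝ)) where
  cons : (t : ℕ) → (Finset.Iic t → Z) → ℝ
  hold : (t : ℕ) → (Finset.Iic t → Z) → (Fin k → ℝ)

/-- The holdings `x_t` with which the consumer enters period `t`, from initial holdings `x₀`. -/
def Plan.entering (π : Plan Z) (x₀ : Fin k → ℝ) : (t : ℕ) → (Finset.Iic t → Z) → (Fin k → ℝ)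
  | 0, _ => x₀
  | t + 1, h => π.hold t (Preorder.frestrictLe₂ (π := fun _ => Z) (Nat.le_succ t) h)

/-- Feasibility at prices `p` from initial holdings `x₀` and initial state `z₀`: consumption and
holdings are measurable functions of the history, nonnegative, and satisfy the budget constraint
`c_t + x_{t+1}ᵀ p(z_t) ≤ x_tᵀ (z_t + p(z_t))` at every history starting at `z₀`. -/
structure Plan.Feasible (π : Plan Z) (p : Z → Fin k → ℝ) (x₀ : Fin k → ℝ) (z₀ : Z) : Prop where
  measurable_cons : ∀ t, Measurable (π.cons t)
  measurable_hold : ∀ t, Measurable (π.hold t)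
  cons_nonneg : ∀ t (h : Finset.Iic t → Z), h ⟨0, Finset.mem_Iic.2 (Nat.zero_le t)⟩ = z₀ →
    0 ≤ π.cons t h
  hold_nonneg : ∀ t (h : Finset.Iic t → Z), h ⟨0, Finset.mem_Iic.2 (Nat.zero_le t)⟩ = z₀ →
    ∀ i, 0 ≤ π.hold t h i
  budget : ∀ t (h : Finset.Iic t → Z), h ⟨0, Finset.mem_Iic.2 (Nat.zero_le t)⟩ = z₀ →
    let z : Z := h ⟨t, Finset.mem_Iic.2 le_rfl⟩
    π.cons t h + ∑ i, π.hold t h i * p z i ≤ ∑ i, π.entering x₀ t h i * ((z : Fin k → ℝ) i + p z i)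

/-- Expected discounted utility `E ∑ₜ βᵗ u(c_t)` of a plan, as an element of `[0, ∞]`
(for the nonnegative utility functions considered here). -/
def Plan.utility (π : Plan Z) (β : ℝ) (u : ℝ → ℝ) (Q : Kernel Z Z) [IsMarkovKernel Q] (z₀ : Z) :
    ℝ≥0∞ :=
  ∫⁻ ω, ∑' t : ℕ, ENNReal.ofReal
    (β ^ t * u (π.cons t (Preorder.frestrictLe (π := fun _ => Z) t ω))) ∂(pathLaw Q z₀)

/-- A plan is optimal if it is feasible, has finite value, and no feasible plan does better. -/
def Plan.Optimal (π : Plan Z) (β : ℝ) (u : ℝ → ℝ) (Q : Kernel Z Z) [IsMarkovKernel Q]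
    (p : Z → Fin k → ℝ) (x₀ : Fin k → ℝ) (z₀ : Z) : Prop :=
  π.Feasible p x₀ z₀ ∧ π.utility β u Q z₀ ≠ ⊤ ∧
    ∀ π' : Plan Z, π'.Feasible p x₀ z₀ → π'.utility β u Q z₀ ≤ π.utility β u Q z₀

/-- Market clearing: always hold exactly one unit of each asset and consume all dividends. -/
def clearingPlan (Z : Set (Fin k → ℝ)) : Plan Z where
  cons t h := total (h ⟨t, Finset.mem_Iic.2 le_rfl⟩ : Fin k → ℝ)
  hold _ _ := fun _ => 1

/-- A (stationary) equilibrium price function: it is continuous with values in `ℝᵏ₊`, and from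
every initial state the consumer who starts with one unit of each asset and takes the prices as
given finds it optimal to hold exactly one unit of each asset for ever. -/
structure IsEquilibriumPrice (β : ℝ) (u : ℝ → ℝ) (Q : Kernel Z Z) [IsMarkovKernel Q]
    (p : Z → Fin k → ℝ) : Prop where
  continuous : Continuous p
  nonneg : ∀ z i, 0 ≤ p z i
  optimal : ∀ z₀, (clearingPlan Z).Optimal β u Q p (fun _ => 1) z₀

/-- `h_i(z) = β ∫ z'_i u'(𝟏ᵀz') Q(z, dz')`. -/
def hFun (β : ℝ) (u : ℝ → ℝ) (Q : Kernel Z Z) (i : Fin k) (z : Z) : ℝ :=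
  β * ∫ z' : Z, (z' : Fin k → ℝ) i * marginal u (total (z' : Fin k → ℝ)) ∂(Q z)

/-- `φ` solves the functional equations `φ_i(z) = h_i(z) + β ∫ φ_i(z') Q(z, dz')`, all the
integrals being those of integrable functions. -/
def SolvesLucas (β : ℝ) (u : ℝ → ℝ) (Q : Kernel Z Z) (φ : Fin k → Z → ℝ) : Prop :=
  ∀ i z,
    Integrable (fun z' : Z => (z' : Fin k → ℝ) i * marginal u (total (z' : Fin k → ℝ))) (Q z) ∧
    Integrable (φ i) (Q z) ∧
    φ i z = hFun β u Q i z + β * ∫ z', φ i z' ∂(Q z)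

/-- Dividends follow `z_{t+1} = B z_t + w_t` with i.i.d. shocks of law `ν` on `ℝᵏ₊` with finite
expectation, where `B ≥ 0` entrywise and `B` has operator norm less than one with respect to some
norm `N` of `ℝᵏ`. -/
def LinearDividends (Q : Kernel Z Z) : Prop :=
  ∃ (B : Matrix (Fin k) (Fin k) ℝ) (ν : Measure (Fin k → ℝ)), IsProbabilityMeasure ν ∧
    (∀ i j, 0 ≤ B i j) ∧
    (∃ N : Seminorm ℝ (Fin k → ℝ), (∀ x, N x = 0 → x = 0) ∧
      ∃ q : ℝ, q < 1 ∧ ∀ x, N (B.mulVec x) ≤ q * N x) ∧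
    (∀ᵐ w ∂ν, ∀ i, 0 ≤ w i) ∧
    (∀ i, Integrable (fun w : Fin k → ℝ => w i) ν) ∧
    ∀ z : Z, (Q z).map Subtype.val = ν.map (fun w => B.mulVec (z : Fin k → ℝ) + w)

/-- Dividends follow `z_{i,t+1} = z_{i,t} ^ ρ_i * w_{i,t+1}` with i.i.d. shocks of law `ν` on
`[1, ∞)ᵏ` with finite expectation, where `0 ≤ ρ_i ≤ 1`, and `E w_i < 1 / β` if `ρ_i = 1`. -/
def LogLinearDividends (β : ℝ) (Q : Kernel Z Z) : Prop :=
  ∃ (ρ : Fin k → ℝ) (ν : Measure (Fin k → ℝ)), IsProbabilityMeasure ν ∧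
    (∀ i, 0 ≤ ρ i ∧ ρ i ≤ 1) ∧
    (∀ᵐ w ∂ν, ∀ i, 1 ≤ w i) ∧
    (∀ i, Integrable (fun w : Fin k → ℝ => w i) ν) ∧
    (∀ i, ρ i = 1 → ∫ w, w i ∂ν < 1 / β) ∧
    ∀ z : Z, (Q z).map Subtype.val = ν.map (fun w i => (z : Fin k → ℝ) i ^ ρ i * w i)

end

end Lucas

namespace Lucas

variable {k : ℕ} {Z : Set (Fin k → ℝ)}

/-! Everything is controlled by one affine weight V(z) = Aᵀz + b with A ≥ 1, b ≥ 1, whose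
conditional expectation one period ahead is at most r V(z) with βr < 1, while integration against Q
preserves continuity of functions of size O(V) (`WeightedFeller`). Discounted expectations of such
functions then decay like (βr)ᵗ.

Prices: since c u'(c) ≤ γc + δ, the function g_i(z) = z_i u'(𝟏ᵀz) is O(V). With T the transition
operator, the series φ_i = ∑_{n≥1} βⁿTⁿg_i converges to a continuous solution that is O(V)
(`exists_solution`). Dividing by u' ≥ a gives the affine bound on p_i.

Optimality: put ψ_i = g_i + φ_i = u'·(z_i + p_i), so that φ_i = βTψ_i is the Euler equation. The
tangent inequality for u and the budget constraint bound the utility gain of a rival plan in each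
period by a difference of portfolio values. These differences telescope, the rival's terminal
portfolio is nonnegative, and the terminal value of the unit portfolio vanishes because βr < 1
(`clearingPlan_optimal`).

Weights: both laws are affine in the shock, so it suffices to bound the mean of Aᵀz' by r₀Aᵀz + C
with 1 ≤ r₀ < 1/β; a large b absorbs C (`exists_weightedFeller_of_affine_shock`). For (M1), A is a
truncated Neumann sum of B; for (M2), A = 𝟏, and the powers with ρ_i < 1 are flattened into affine
functions. -/

/-- A concave function on `[0, ∞)` lies below its tangents. -/
theorem le_tangent_of_concaveOn {u : ℝ → ℝ} (hd : DifferentiableOn ℝ u (Ici 0))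
    (hu : ConcaveOn ℝ (Ici 0) u) {c y : ℝ} (hc : 0 ≤ c) (hy : 0 ≤ y) :
    u c ≤ u y + marginal u y * (c - y) := by
  have hder : HasDerivWithinAt u (marginal u y) (Ici 0) y := (hd y hy).hasDerivWithinAt
  rcases lt_trichotomy c y with h | h | h
  · have := hu.le_slope_of_hasDerivWithinAt hc hy h hder
    rw [slope_def_field, le_div_iff₀ (by linarith)] at this
    linarith
  · simp [h]
  · have := hu.slope_le_of_hasDerivWithinAt hy hc h hder
    rw [slope_def_field, div_le_iff₀ (by linarith)] at this
    linarith

theorem total_nonneg {z : Fin k → ℝ} (hz : ∀ i, 0 ≤ z i) : 0 ≤ total z :=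
  Finset.sum_nonneg fun i _ => hz i

theorem continuous_total : Continuous (total (k := k)) := by
  unfold total; fun_prop

/-! ### Drift weights and the functional equation -/

/-- A transition function with the Feller property for continuous functions dominated by a
continuous weight `V ≥ 1`, together with the drift condition `∫ V dQ(z, ·) ≤ r V(z)`. -/
structure WeightedFeller (Q : Kernel Z Z) (V : Z → ℝ) (r : ℝ) : Prop where
  continuous_weight : Continuous V
  one_le : ∀ z, 1 ≤ V z
  integrable_weight : ∀ z, Integrable V (Q z)
  drift : ∀ z, ∫ z', V z' ∂(Q z) ≤ r * V z
  continuous_integral : ∀ f : Z → ℝ, Continuous f → ∀ K : ℝ, (∀ z, |f z| ≤ K * V z) →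
    Continuous fun z => ∫ z', f z' ∂(Q z)

namespace WeightedFeller

variable {Q : Kernel Z Z} {V : Z → ℝ} {r β : ℝ}

theorem weight_nonneg (hV : WeightedFeller Q V r) (z : Z) : 0 ≤ V z :=
  zero_le_one.trans (hV.one_le z)

theorem integrable (hV : WeightedFeller Q V r) {f : Z → ℝ} (hf : Continuous f) {K : ℝ}
    (hK : ∀ z, |f z| ≤ K * V z) (z : Z) : Integrable f (Q z) :=
  ((hV.integrable_weight z).const_mul K).mono' hf.measurable.aestronglyMeasurable
    (Filter.Eventually.of_forall fun z' => by simpa using hK z')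

theorem integral_le (hV : WeightedFeller Q V r) {f : Z → ℝ} (hf : Continuous f) {K : ℝ}
    (hK0 : 0 ≤ K) (h0 : ∀ z, 0 ≤ f z) (hK : ∀ z, f z ≤ K * V z) (z : Z) :
    ∫ z', f z' ∂(Q z) ≤ K * r * V z := by
  calc ∫ z', f z' ∂(Q z) ≤ ∫ z', K * V z' ∂(Q z) :=
        integral_mono (hV.integrable hf (K := K) (fun z => by rw [abs_of_nonneg (h0 z)]; exact hK z) z)
          ((hV.integrable_weight z).const_mul K) hK
    _ = K * ∫ z', V z' ∂(Q z) := integral_const_mul _ _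
    _ ≤ K * (r * V z) := mul_le_mul_of_nonneg_left (hV.drift z) hK0
    _ = K * r * V z := by ring

/-- The iterates `z ↦ E[g(z_n) | z_0 = z]` of the transition operator. -/
noncomputable def iter (Q : Kernel Z Z) (g : Z → ℝ) : ℕ → Z → ℝ
  | 0 => g
  | n + 1 => fun z => ∫ z', iter Q g n z' ∂(Q z)

theorem iter_bounds (hV : WeightedFeller Q V r) (hr : 0 ≤ r) {g : Z → ℝ} (hg : Continuous g)
    (hg0 : ∀ z, 0 ≤ g z) {K : ℝ} (hK0 : 0 ≤ K) (hgK : ∀ z, g z ≤ K * V z) (n : ℕ) :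
    Continuous (iter Q g n) ∧ (∀ z, 0 ≤ iter Q g n z) ∧
      ∀ z, iter Q g n z ≤ K * r ^ n * V z := by
  induction n with
  | zero => exact ⟨hg, hg0, fun z => by simpa [iter] using hgK z⟩
  | succ n ih =>
    obtain ⟨h1, h2, h3⟩ := ih
    refine ⟨hV.continuous_integral _ h1 (K * r ^ n)
      (fun z => by rw [abs_of_nonneg (h2 z)]; exact h3 z), fun z => integral_nonneg h2, fun z => ?_⟩
    have := hV.integral_le h1 (by positivity) h2 h3 z
    rw [pow_succ, ← mul_assoc]
    exact this

/-- The functional equation `φ = β T g + β T φ` has a continuous nonnegative solution dominated by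
the weight whenever `g` is, provided `β r < 1`. -/
theorem exists_solution (hV : WeightedFeller Q V r) (hr : 0 ≤ r) (hβ : 0 ≤ β) (hβr : β * r < 1)
    {g : Z → ℝ} (hg : Continuous g)
    (hg0 : ∀ z, 0 ≤ g z) {K : ℝ} (hK0 : 0 ≤ K) (hgK : ∀ z, g z ≤ K * V z) :
    ∃ (φ : Z → ℝ) (L : ℝ), 0 ≤ L ∧ Continuous φ ∧ (∀ z, 0 ≤ φ z) ∧ (∀ z, φ z ≤ L * V z) ∧
      ∀ z, φ z = β * ∫ z', g z' ∂(Q z) + β * ∫ z', φ z' ∂(Q z) := by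
  have hb := hV.iter_bounds hr hg hg0 hK0 hgK
  set T := iter Q g with hT
  have hq0 : 0 ≤ β * r := mul_nonneg hβ hr
  have hsum : Summable fun n : ℕ => K * (β * r) ^ (n + 1) :=
    ((summable_nat_add_iff 1).2 (summable_geometric_of_lt_one hq0 hβr)).mul_left K
  have hle : ∀ n z, β ^ (n + 1) * T (n + 1) z ≤ K * (β * r) ^ (n + 1) * V z := fun n z =>
    calc β ^ (n + 1) * T (n + 1) z ≤ β ^ (n + 1) * (K * r ^ (n + 1) * V z) :=
          mul_le_mul_of_nonneg_left ((hb _).2.2 z) (by positivity)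
      _ = K * (β * r) ^ (n + 1) * V z := by rw [mul_pow]; ring
  have hnn : ∀ n z, 0 ≤ β ^ (n + 1) * T (n + 1) z := fun n z =>
    mul_nonneg (by positivity) ((hb _).2.1 z)
  have hsz : ∀ z, Summable fun n => β ^ (n + 1) * T (n + 1) z := fun z =>
    Summable.of_nonneg_of_le (fun n => hnn n z) (fun n => hle n z) (hsum.mul_right _)
  have hcont : Continuous fun z => ∑' n, β ^ (n + 1) * T (n + 1) z := by
    -- The terms are bounded only relative to V. Dividing by V makes the bound K(βr)ⁿ⁺¹ uniform in
    -- z, so the M-test applies.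
    have h1 : Continuous fun z => ∑' n, β ^ (n + 1) * T (n + 1) z / V z := by
      refine continuous_tsum (fun n => ?_) hsum fun n z => ?_
      · exact (continuous_const.mul (hb _).1).div hV.continuous_weight
          fun z => (zero_lt_one.trans_le (hV.one_le z)).ne'
      · have hpos := zero_lt_one.trans_le (hV.one_le z)
        rw [Real.norm_of_nonneg (div_nonneg (hnn n z) hpos.le), div_le_iff₀ hpos]
        exact hle n z
    refine (h1.mul hV.continuous_weight).congr fun z => ?_
    simp only [Pi.mul_apply]
    rw [tsum_div_const, div_mul_cancel₀ _ (zero_lt_one.trans_le (hV.one_le z)).ne']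
  refine ⟨fun z => ∑' n, β ^ (n + 1) * T (n + 1) z, ∑' n, K * (β * r) ^ (n + 1),
    tsum_nonneg fun n => by positivity, hcont, fun z => tsum_nonneg fun n => hnn n z, fun z => ?_,
    fun z => ?_⟩
  · rw [← tsum_mul_right]
    exact (hsz z).tsum_le_tsum (fun n => hle n z) (hsum.mul_right _)
  · have hint : ∀ n z, ∫ z', β ^ (n + 1) * T (n + 1) z' ∂(Q z) = β ^ (n + 1) * T (n + 2) z :=
      fun n z => integral_const_mul _ _
    have hI : ∀ n, Integrable (fun z' => β ^ (n + 1) * T (n + 1) z') (Q z) := fun n =>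
      hV.integrable (f := fun z' => β ^ (n + 1) * T (n + 1) z') (continuous_const.mul (hb _).1)
        (K := K * (β * r) ^ (n + 1)) (fun z => by rw [abs_of_nonneg (hnn n z)]; exact hle n z) z
    have hTsum : ∫ z', ∑' n, β ^ (n + 1) * T (n + 1) z' ∂(Q z)
        = ∑' n, β ^ (n + 1) * T (n + 2) z := by
      rw [← integral_tsum_of_summable_integral_norm hI]
      · exact tsum_congr fun n => hint n z
      · have : (fun n => ∫ z', ‖β ^ (n + 1) * T (n + 1) z'‖ ∂(Q z))
            = fun n => β ^ (n + 1) * T (n + 2) z := by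
          funext n
          rw [← hint n z]
          exact integral_congr_ae (Filter.Eventually.of_forall fun z' =>
            Real.norm_of_nonneg (hnn n z'))
        rw [this]
        refine Summable.of_nonneg_of_le
          (fun n => mul_nonneg (by positivity) ((hb _).2.1 z)) (fun n => ?_) (hsum.mul_right (r * V z))
        calc β ^ (n + 1) * T (n + 2) z ≤ β ^ (n + 1) * (K * r ^ (n + 2) * V z) :=
              mul_le_mul_of_nonneg_left ((hb _).2.2 z) (by positivity)
          _ = K * (β * r) ^ (n + 1) * (r * V z) := by rw [mul_pow]; ring
    beta_reduce
    -- The leading term of the series is β∫g; the remaining terms are β times the integrated series.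
    rw [hTsum, (hsz z).tsum_eq_zero_add, ← tsum_mul_left]
    congr 1
    · simp [hT, iter]
    · exact tsum_congr fun n => by ring

end WeightedFeller

/-! ### The law of the dividend path -/

instance (Q : Kernel Z Z) [IsMarkovKernel Q] (z₀ : Z) : IsProbabilityMeasure (pathLaw Q z₀) := by
  unfold pathLaw; infer_instance

/-- Feasibility constrains only histories starting at z₀; this makes the constraints available
almost surely. -/
theorem pathLaw_start (Q : Kernel Z Z) [IsMarkovKernel Q] (z₀ : Z) :
    ∀ᵐ ω ∂(pathLaw Q z₀), ω 0 = z₀ := by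
  have h := Kernel.traj_map_frestrictLe_apply (X := fun _ => Z)
    (κ := fun n => Q.comap (fun h : Finset.Iic n → Z => h ⟨n, Finset.mem_Iic.2 le_rfl⟩)
      (measurable_pi_apply _)) 0 0 (fun _ => z₀)
  rw [Kernel.partialTraj_self, Kernel.id_apply] at h
  have h2 : ∀ᵐ x ∂((pathLaw Q z₀).map (Preorder.frestrictLe (π := fun _ => Z) 0)),
      x ⟨0, Finset.mem_Iic.2 le_rfl⟩ = z₀ := by
    unfold pathLaw
    rw [h]
    exact (ae_dirac_iff (measurableSet_eq_fun (measurable_pi_apply _) measurable_const)).2 rfl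
  exact ae_of_ae_map (by fun_prop) h2

/-- The Markov property of the dividend path. -/
theorem lintegral_pathLaw_succ (Q : Kernel Z Z) [IsMarkovKernel Q] (z₀ : Z) (t : ℕ)
    {F : (Finset.Iic t → Z) × Z → ℝ≥0∞} (hF : Measurable F) :
    ∫⁻ ω, F (Preorder.frestrictLe (π := fun _ => Z) t ω, ω (t + 1)) ∂(pathLaw Q z₀)
      = ∫⁻ ω, ∫⁻ z', F (Preorder.frestrictLe (π := fun _ => Z) t ω, z') ∂(Q (ω t))
          ∂(pathLaw Q z₀) := by
  have h := Kernel.partialTraj_compProd_eq_map_traj (X := fun _ => Z)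
    (κ := fun n => Q.comap (fun h : Finset.Iic n → Z => h ⟨n, Finset.mem_Iic.2 le_rfl⟩)
      (measurable_pi_apply _)) (Nat.zero_le t) (x₀ := fun _ => z₀)
  have h1 := congrArg (fun μ => ∫⁻ x, F x ∂μ) h
  beta_reduce at h1
  rw [lintegral_map hF (by fun_prop), Measure.lintegral_compProd hF,
    ← Kernel.traj_map_frestrictLe_apply, lintegral_map _ (by fun_prop)] at h1
  · exact h1.symm
  · exact Measurable.lintegral_kernel_prod_right' hF

/-- The drift inequality is iterated along the path by the Markov property. -/
theorem lintegral_weight_le {Q : Kernel Z Z} [IsMarkovKernel Q] {V : Z → ℝ} {r : ℝ}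
    (hV : WeightedFeller Q V r) (hr : 0 ≤ r) (z₀ : Z) (t : ℕ) :
    ∫⁻ ω, ENNReal.ofReal (V (ω t)) ∂(pathLaw Q z₀) ≤ ENNReal.ofReal (r ^ t * V z₀) := by
  have hm : Measurable fun z => ENNReal.ofReal (V z) :=
    hV.continuous_weight.measurable.ennreal_ofReal
  induction t with
  | zero =>
    have : ∫⁻ ω, ENNReal.ofReal (V (ω 0)) ∂(pathLaw Q z₀)
        = ∫⁻ _, ENNReal.ofReal (V z₀) ∂(pathLaw Q z₀) :=
      lintegral_congr_ae ((pathLaw_start Q z₀).mono fun ω h => by simp only [h])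
    simp [this]
  | succ t ih =>
    rw [lintegral_pathLaw_succ Q z₀ t (F := fun x => ENNReal.ofReal (V x.2))
      (hm.comp measurable_snd)]
    calc ∫⁻ ω, ∫⁻ z', ENNReal.ofReal (V z') ∂(Q (ω t)) ∂(pathLaw Q z₀)
        ≤ ∫⁻ ω, ENNReal.ofReal r * ENNReal.ofReal (V (ω t)) ∂(pathLaw Q z₀) := by
          refine lintegral_mono fun ω => ?_
          rw [← ofReal_integral_eq_lintegral_ofReal (hV.integrable_weight _)
            (Filter.Eventually.of_forall hV.weight_nonneg), ← ENNReal.ofReal_mul hr]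
          exact ENNReal.ofReal_le_ofReal (hV.drift _)
      _ = ENNReal.ofReal r * ∫⁻ ω, ENNReal.ofReal (V (ω t)) ∂(pathLaw Q z₀) :=
          lintegral_const_mul _ (hm.comp (measurable_pi_apply t))
      _ ≤ ENNReal.ofReal r * ENNReal.ofReal (r ^ t * V z₀) := by gcongr
      _ = ENNReal.ofReal (r ^ (t + 1) * V z₀) := by
          rw [← ENNReal.ofReal_mul hr]; ring_nf

theorem lintegral_le_of_le_weight {Q : Kernel Z Z} [IsMarkovKernel Q] {V : Z → ℝ} {r : ℝ}
    (hV : WeightedFeller Q V r) (hr : 0 ≤ r) {f : Z → ℝ} {K : ℝ} (hK0 : 0 ≤ K)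
    (hf : ∀ z, f z ≤ K * V z) (z₀ : Z) (t : ℕ) :
    ∫⁻ ω, ENNReal.ofReal (f (ω t)) ∂(pathLaw Q z₀) ≤ ENNReal.ofReal (K * r ^ t * V z₀) := by
  have hm : Measurable fun z => ENNReal.ofReal (V z) :=
    hV.continuous_weight.measurable.ennreal_ofReal
  calc ∫⁻ ω, ENNReal.ofReal (f (ω t)) ∂(pathLaw Q z₀)
      ≤ ∫⁻ ω, ENNReal.ofReal K * ENNReal.ofReal (V (ω t)) ∂(pathLaw Q z₀) :=
        lintegral_mono fun ω => by
          rw [← ENNReal.ofReal_mul hK0]; exact ENNReal.ofReal_le_ofReal (hf _)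
    _ = ENNReal.ofReal K * ∫⁻ ω, ENNReal.ofReal (V (ω t)) ∂(pathLaw Q z₀) :=
        lintegral_const_mul _ (hm.comp (measurable_pi_apply t))
    _ ≤ ENNReal.ofReal K * ENNReal.ofReal (r ^ t * V z₀) := by
        gcongr; exact lintegral_weight_le hV hr z₀ t
    _ = ENNReal.ofReal (K * r ^ t * V z₀) := by rw [← ENNReal.ofReal_mul hK0, mul_assoc]

/-! ### Portfolio values and sufficiency of the Euler equations -/

/-- Expected value of the portfolio `x`, a function of the history up to `s`, at the
state-dependent prices `ψ` of period `t`. -/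
noncomputable def portfolioValue (Q : Kernel Z Z) [IsMarkovKernel Q] (z₀ : Z) (s t : ℕ)
    (x : (Finset.Iic s → Z) → Fin k → ℝ) (ψ : Fin k → Z → ℝ) : ℝ≥0∞ :=
  ∫⁻ ω, ∑ i, ENNReal.ofReal (x (Preorder.frestrictLe (π := fun _ => Z) s ω) i) *
    ENNReal.ofReal (ψ i (ω t)) ∂(pathLaw Q z₀)

/-- If `φ` is the discounted conditional expectation of `ψ`, portfolios chosen in period `t`
are worth the same at `φ` in period `t` as at `ψ` in the next period, discounted. -/
theorem portfolioValue_succ {Q : Kernel Z Z} [IsMarkovKernel Q] (z₀ : Z) (t : ℕ)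
    {x : (Finset.Iic t → Z) → Fin k → ℝ} (hx : Measurable x) {φ ψ : Fin k → Z → ℝ}
    {β : ℝ} (hβ : 0 ≤ β) (hψm : ∀ i, Measurable (ψ i)) (hψ0 : ∀ i z, 0 ≤ ψ i z)
    (hψi : ∀ i z, Integrable (ψ i) (Q z)) (hφ : ∀ i z, φ i z = β * ∫ z', ψ i z' ∂(Q z)) :
    portfolioValue Q z₀ t t x φ
      = ENNReal.ofReal β * portfolioValue Q z₀ t (t + 1) x ψ := by
  have hxm : ∀ i, Measurable fun h => ENNReal.ofReal (x h i) := fun i =>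
    ((measurable_pi_apply i).comp hx).ennreal_ofReal
  have hψm' : ∀ i, Measurable fun z => ENNReal.ofReal (ψ i z) := fun i => (hψm i).ennreal_ofReal
  have hFm : Measurable fun y : (Finset.Iic t → Z) × Z =>
      ∑ i, ENNReal.ofReal (x y.1 i) * ENNReal.ofReal (ψ i y.2) :=
    Finset.measurable_sum _ fun i _ =>
      ((hxm i).comp measurable_fst).mul ((hψm' i).comp measurable_snd)
  unfold portfolioValue
  rw [lintegral_pathLaw_succ Q z₀ t hFm, ← lintegral_const_mul' _ _ ENNReal.ofReal_ne_top]
  refine lintegral_congr fun ω => ?_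
  change _ = ENNReal.ofReal β * ∫⁻ z', ∑ i, ENNReal.ofReal
    (x (Preorder.frestrictLe (π := fun _ => Z) t ω) i) * ENNReal.ofReal (ψ i z') ∂(Q (ω t))
  rw [lintegral_finsetSum _ fun i _ => (hψm' i).const_mul _, Finset.mul_sum]
  refine Finset.sum_congr rfl fun i _ => ?_
  rw [lintegral_const_mul _ (hψm' i), hφ, ENNReal.ofReal_mul hβ,
    ofReal_integral_eq_lintegral_ofReal (hψi i _) (Filter.Eventually.of_forall (hψ0 i))]
  ring

theorem sum_ofReal_mul_ofReal {a b : Fin k → ℝ} (ha : ∀ i, 0 ≤ a i) (hb : ∀ i, 0 ≤ b i) :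
    ∑ i, ENNReal.ofReal (a i) * ENNReal.ofReal (b i) = ENNReal.ofReal (∑ i, a i * b i) := by
  rw [ENNReal.ofReal_sum_of_nonneg fun i _ => mul_nonneg (ha i) (hb i)]
  exact Finset.sum_congr rfl fun i _ => (ENNReal.ofReal_mul (ha i)).symm

theorem Plan.Feasible.entering_nonneg {π : Plan Z} {p : Z → Fin k → ℝ} {x₀ : Fin k → ℝ} {z₀ : Z}
    (hπ : π.Feasible p x₀ z₀) (hx₀ : ∀ i, 0 ≤ x₀ i) (t : ℕ) (h : Finset.Iic t → Z)
    (h0 : h ⟨0, Finset.mem_Iic.2 (Nat.zero_le t)⟩ = z₀) (i : Fin k) :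
    0 ≤ π.entering x₀ t h i := by
  cases t with
  | zero => exact hx₀ i
  | succ t => exact hπ.hold_nonneg t _ h0 i

theorem clearingPlan_feasible (hZ : ∀ z ∈ Z, ∀ i, 0 ≤ z i) (p : Z → Fin k → ℝ) (z₀ : Z) :
    (clearingPlan Z).Feasible p (fun _ => 1) z₀ where
  measurable_cons t := continuous_total.measurable.comp
    (measurable_subtype_coe.comp (measurable_pi_apply _))
  measurable_hold t := measurable_const
  cons_nonneg t h _ := total_nonneg (hZ _ (h _).2)
  hold_nonneg t h _ i := zero_le_one
  budget t h _ := by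
    have : (clearingPlan Z).entering (fun _ => 1) t h = fun _ => 1 := by cases t <;> rfl
    rw [this]
    simp only [clearingPlan, total, one_mul, Finset.sum_add_distrib, le_refl]

theorem Plan.Feasible.aemeasurable_utility {π : Plan Z} {p : Z → Fin k → ℝ} {x₀ : Fin k → ℝ}
    {z₀ : Z} (hπ : π.Feasible p x₀ z₀) {u : ℝ → ℝ} (hu : ContinuousOn u (Ici 0))
    (Q : Kernel Z Z) [IsMarkovKernel Q] (t : ℕ) :
    AEMeasurable (fun ω => ENNReal.ofReal
      (u (π.cons t (Preorder.frestrictLe (π := fun _ => Z) t ω)))) (pathLaw Q z₀) := by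
  have hc : Continuous fun c : ℝ => u (max c 0) :=
    hu.comp_continuous (by fun_prop) fun c => le_max_right c 0
  -- Off [0, ∞) nothing is known about u, so consumption is truncated at 0; almost surely this
  -- changes nothing.
  refine ⟨fun ω => ENNReal.ofReal
      (u (max (π.cons t (Preorder.frestrictLe (π := fun _ => Z) t ω)) 0)), ?_, ?_⟩
  · exact (hc.measurable.comp ((hπ.measurable_cons t).comp (by fun_prop))).ennreal_ofReal
  · filter_upwards [pathLaw_start Q z₀] with ω hω
    rw [max_eq_left (hπ.cons_nonneg t _ hω)]

theorem Plan.Feasible.utility_eq_tsum {π : Plan Z} {p : Z → Fin k → ℝ} {x₀ : Fin k → ℝ}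
    {z₀ : Z} (hπ : π.Feasible p x₀ z₀) {u : ℝ → ℝ} (hu : ContinuousOn u (Ici 0))
    {β : ℝ} (hβ : 0 ≤ β) (Q : Kernel Z Z) [IsMarkovKernel Q] :
    π.utility β u Q z₀ = ∑' t : ℕ, ENNReal.ofReal β ^ t * ∫⁻ ω, ENNReal.ofReal
      (u (π.cons t (Preorder.frestrictLe (π := fun _ => Z) t ω))) ∂(pathLaw Q z₀) := by
  have h := hπ.aemeasurable_utility hu Q
  unfold Plan.utility
  simp only [ENNReal.ofReal_mul (pow_nonneg hβ _), ENNReal.ofReal_pow hβ]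
  rw [lintegral_tsum fun t => (h t).const_mul _]
  exact tsum_congr fun t => lintegral_const_mul' _ _ (by simp)

/-- Sufficiency of the Euler equations: prices whose utility value `φ i = p i * u'` solves the
functional equation and grows at most like the weight `V` support the market-clearing plan. -/
theorem clearingPlan_optimal {Q : Kernel Z Z} [IsMarkovKernel Q] {V : Z → ℝ} {r β : ℝ}
    (hV : WeightedFeller Q V r) (hr : 0 ≤ r) (hβ : 0 ≤ β) (hβr : β * r < 1)
    (hZ : ∀ z ∈ Z, ∀ i, 0 ≤ z i) {u : ℝ → ℝ} (hu0 : u 0 = 0)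
    (hu : ContinuousOn u (Ici 0)) (hpos : ∀ c, 0 ≤ c → 0 < marginal u c)
    (htan : ∀ c y, 0 ≤ c → 0 ≤ y → u c ≤ u y + marginal u y * (c - y))
    {K : ℝ} (hK0 : 0 ≤ K) (hK : ∀ z : Z, total (z : Fin k → ℝ) ≤ K * V z)
    {ψ φ : Fin k → Z → ℝ} (hψc : ∀ i, Continuous (ψ i)) {L : ℝ} (hL0 : 0 ≤ L)
    (hψL : ∀ i z, ψ i z ≤ L * V z) (hφ0 : ∀ i z, 0 ≤ φ i z)
    (hφ : ∀ i z, φ i z = β * ∫ z', ψ i z' ∂(Q z))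
    (hψ : ∀ i (z : Z), ψ i z =
      (z : Fin k → ℝ) i * marginal u (total (z : Fin k → ℝ)) + φ i z)
    {p : Z → Fin k → ℝ} (hp : ∀ z i, φ i z = p z i * marginal u (total (z : Fin k → ℝ)))
    (z₀ : Z) : (clearingPlan Z).Optimal β u Q p (fun _ => 1) z₀ := by
  have htot : ∀ z : Z, 0 ≤ total (z : Fin k → ℝ) := fun z => total_nonneg (hZ z z.2)
  have hu_nonneg : ∀ c, 0 ≤ c → 0 ≤ u c := fun c hc => by
    -- The tangent at c, evaluated at 0, gives u(c) ≥ c u'(c) ≥ 0.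
    have := htan 0 c le_rfl hc
    nlinarith [mul_nonneg (hpos c hc).le hc]
  have hψ0 : ∀ i z, 0 ≤ ψ i z := fun i z => by
    rw [hψ]
    exact add_nonneg (mul_nonneg (hZ z z.2 i) (hpos _ (htot z)).le) (hφ0 i z)
  have hclear := clearingPlan_feasible hZ p z₀
  have hψi : ∀ i z, Integrable (ψ i) (Q z) := fun i z =>
    hV.integrable (hψc i) (fun z => by rw [abs_of_nonneg (hψ0 i z)]; exact hψL i z) z
  have hψm : ∀ i, Measurable (ψ i) := fun i => (hψc i).measurable
  have hφm : ∀ i, Measurable (φ i) := fun i => by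
    have : φ i = fun z => ψ i z - (z : Fin k → ℝ) i * marginal u (total (z : Fin k → ℝ)) := by
      funext z; rw [hψ]; ring
    have h2 : Continuous fun z => ∫ z', ψ i z' ∂(Q z) := hV.continuous_integral _ (hψc i) L
      fun z => by rw [abs_of_nonneg (hψ0 i z)]; exact hψL i z
    exact ((continuous_const.mul h2).congr fun z => (hφ i z).symm).measurable
  set B := ENNReal.ofReal β with hB
  set Y : ℕ → ℝ≥0∞ := fun t => ∫⁻ ω, ENNReal.ofReal (u (total (ω t : Fin k → ℝ))) ∂(pathLaw Q z₀)
    with hY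
  set I : ℕ → ℝ≥0∞ := fun t => portfolioValue Q z₀ t t (fun _ _ => 1) ψ with hI
  have hbound : ∀ D, 0 ≤ D → ∀ t, B ^ t * ENNReal.ofReal (D * r ^ t * V z₀)
      = ENNReal.ofReal (D * V z₀ * (β * r) ^ t) := fun D hD t => by
    rw [hB, ← ENNReal.ofReal_pow hβ, ← ENNReal.ofReal_mul (by positivity), mul_pow]
    congr 1; ring
  have hYutil : (clearingPlan Z).utility β u Q z₀ = ∑' t, B ^ t * Y t :=
    hclear.utility_eq_tsum hu hβ Q
  have hYfin : (clearingPlan Z).utility β u Q z₀ ≠ ⊤ := by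
    have hD : 0 ≤ marginal u 0 * K := mul_nonneg (hpos 0 le_rfl).le hK0
    -- The tangent at 0 gives u(c) ≤ u'(0)c, hence u(𝟏ᵀz) ≤ u'(0) K V(z).
    have hle : ∀ t, B ^ t * Y t ≤ ENNReal.ofReal (marginal u 0 * K * V z₀ * (β * r) ^ t) := by
      intro t
      rw [← hbound _ hD t]
      gcongr
      refine lintegral_le_of_le_weight hV hr (f := fun z => u (total (z : Fin k → ℝ))) hD
        (fun z => ?_) z₀ t
      have h1 := htan (total (z : Fin k → ℝ)) 0 (htot z) le_rfl
      have h2 := mul_le_mul_of_nonneg_left (hK z) (hpos 0 le_rfl).le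
      rw [hu0] at h1
      linarith
    rw [hYutil]
    refine ne_top_of_le_ne_top ?_ (ENNReal.tsum_le_tsum hle)
    rw [← ENNReal.ofReal_tsum_of_nonneg]
    · exact ENNReal.ofReal_ne_top
    · intro t
      have := hV.weight_nonneg z₀
      positivity
    · exact (summable_geometric_of_lt_one (mul_nonneg hβ hr) hβr).mul_left _
  have hIle : ∀ t, B ^ t * I t ≤ ENNReal.ofReal (k * L * V z₀ * (β * r) ^ t) := by
    intro t
    rw [← hbound _ (by positivity) t]
    gcongr
    have : I t = ∫⁻ ω, ENNReal.ofReal (∑ i, ψ i (ω t)) ∂(pathLaw Q z₀) := by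
      refine lintegral_congr fun ω => ?_
      rw [sum_ofReal_mul_ofReal (fun _ => zero_le_one) fun i => hψ0 i _]
      simp
    rw [this]
    refine lintegral_le_of_le_weight hV hr (f := fun z => ∑ i, ψ i z) (by positivity)
      (fun z => ?_) z₀ t
    calc ∑ i, ψ i z ≤ ∑ _i : Fin k, L * V z := Finset.sum_le_sum fun i _ => hψL i z
      _ = k * L * V z := by simp; ring
  have hIfin : ∀ t, B ^ t * I t ≠ ⊤ := fun t =>
    ne_top_of_le_ne_top ENNReal.ofReal_ne_top (hIle t)
  refine ⟨hclear, hYfin, fun π hπ => ?_⟩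
  set C : ℕ → ℝ≥0∞ := fun t => ∫⁻ ω, ENNReal.ofReal
    (u (π.cons t (Preorder.frestrictLe (π := fun _ => Z) t ω))) ∂(pathLaw Q z₀) with hC
  set X : ℕ → ℝ≥0∞ := fun t => portfolioValue Q z₀ t t (π.entering (fun _ => 1) t) ψ with hX
  have hmeas : ∀ (s t : ℕ) (x : (Finset.Iic s → Z) → Fin k → ℝ) (f : Fin k → Z → ℝ),
      Measurable x → (∀ i, Measurable (f i)) → Measurable fun ω : ℕ → Z =>
        ∑ i, ENNReal.ofReal (x (Preorder.frestrictLe (π := fun _ => Z) s ω) i) *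
          ENNReal.ofReal (f i (ω t)) := by
    intro s t x f hx hf
    have h1 : ∀ i, Measurable fun ω : ℕ → Z =>
        ENNReal.ofReal (x (Preorder.frestrictLe (π := fun _ => Z) s ω) i) := fun i =>
      (((measurable_pi_apply i).comp hx).comp (Preorder.measurable_frestrictLe s)).ennreal_ofReal
    have h2 : ∀ i, Measurable fun ω : ℕ → Z => ENNReal.ofReal (f i (ω t)) := fun i =>
      ((hf i).comp (measurable_pi_apply t)).ennreal_ofReal
    exact Finset.measurable_sum _ fun i _ => (h1 i).mul (h2 i)
  -- One-period comparison, arranged without subtraction because the values lie in [0, ∞] and X may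
  -- be infinite. Pointwise, u(c) ≤ u(𝟏ᵀz) + u'(𝟏ᵀz)(c − 𝟏ᵀz), and the budget multiplied by u'
  -- bounds u'c by the entering portfolio at ψ minus the chosen portfolio at φ.
  have hstep : ∀ t, C t + B * X (t + 1) + I t ≤ Y t + X t + B * I (t + 1) := by
    intro t
    have e1 : B * X (t + 1) = portfolioValue Q z₀ t t (π.hold t) φ :=
      (portfolioValue_succ z₀ t (hπ.measurable_hold t) hβ hψm hψ0 hψi hφ).symm
    have e2 : B * I (t + 1) = portfolioValue Q z₀ t t (fun _ _ => 1) φ :=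
      (portfolioValue_succ z₀ t measurable_const hβ hψm hψ0 hψi hφ).symm
    rw [e1, e2]
    simp only [hC, hY, hX, hI, portfolioValue]
    have hYm : Measurable fun ω : ℕ → Z => ENNReal.ofReal (u (total (ω t : Fin k → ℝ))) := by
      have hc : Continuous fun z : Z => u (total (z : Fin k → ℝ)) :=
        hu.comp_continuous (continuous_total.comp continuous_subtype_val) htot
      exact (hc.measurable.comp (measurable_pi_apply t)).ennreal_ofReal
    rw [← lintegral_add_right _ (hmeas t t _ _ (hπ.measurable_hold t) hφm),
      ← lintegral_add_right _ (hmeas t t _ _ measurable_const hψm),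
      ← lintegral_add_left hYm,
      ← lintegral_add_right _ (hmeas t t _ _ measurable_const hφm)]
    refine lintegral_mono_ae ?_
    filter_upwards [pathLaw_start Q z₀] with ω hω
    set h := Preorder.frestrictLe (π := fun _ => Z) t ω with hh
    have h0 : h ⟨0, Finset.mem_Iic.2 (Nat.zero_le t)⟩ = z₀ := hω
    have hcn := hπ.cons_nonneg t h h0
    have hxn := hπ.hold_nonneg t h h0
    have hen := hπ.entering_nonneg (fun _ => zero_le_one) t h h0
    have hbud := hπ.budget t h h0
    change π.cons t h + ∑ i, π.hold t h i * p (ω t) i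
      ≤ ∑ i, π.entering (fun _ => 1) t h i * ((ω t : Fin k → ℝ) i + p (ω t) i) at hbud
    have hz := htot (ω t)
    rw [sum_ofReal_mul_ofReal hxn fun i => hφ0 i _,
      sum_ofReal_mul_ofReal hen fun i => hψ0 i _,
      sum_ofReal_mul_ofReal (fun _ => zero_le_one) fun i => hφ0 i _,
      sum_ofReal_mul_ofReal (fun _ => zero_le_one) fun i => hψ0 i _,
      ← ENNReal.ofReal_add (hu_nonneg _ hcn)
        (Finset.sum_nonneg fun i _ => mul_nonneg (hxn i) (hφ0 i _)),
      ← ENNReal.ofReal_add (add_nonneg (hu_nonneg _ hcn)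
        (Finset.sum_nonneg fun i _ => mul_nonneg (hxn i) (hφ0 i _)))
        (Finset.sum_nonneg fun i _ => mul_nonneg zero_le_one (hψ0 i _)),
      ← ENNReal.ofReal_add (hu_nonneg _ hz)
        (Finset.sum_nonneg fun i _ => mul_nonneg (hen i) (hψ0 i _)),
      ← ENNReal.ofReal_add (add_nonneg (hu_nonneg _ hz)
        (Finset.sum_nonneg fun i _ => mul_nonneg (hen i) (hψ0 i _)))
        (Finset.sum_nonneg fun i _ => mul_nonneg zero_le_one (hφ0 i _))]
    refine ENNReal.ofReal_le_ofReal ?_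
    have ht := htan _ _ hcn hz
    have hm := hpos _ hz
    set M := marginal u (total (ω t : Fin k → ℝ)) with hM
    have s1 : ∑ i, π.hold t h i * φ i (ω t) = M * ∑ i, π.hold t h i * p (ω t) i := by
      rw [Finset.mul_sum]
      exact Finset.sum_congr rfl fun i _ => by rw [hp]; ring
    have s2 : ∑ i, π.entering (fun _ => 1) t h i * ψ i (ω t)
        = M * ∑ i, π.entering (fun _ => 1) t h i * ((ω t : Fin k → ℝ) i + p (ω t) i) := by
      rw [Finset.mul_sum]
      exact Finset.sum_congr rfl fun i _ => by rw [hψ, hp]; ring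
    have s3 : ∑ i, 1 * ψ i (ω t) = M * total (ω t : Fin k → ℝ) + ∑ i, 1 * φ i (ω t) := by
      rw [total, Finset.mul_sum, ← Finset.sum_add_distrib]
      exact Finset.sum_congr rfl fun i _ => by rw [hψ]; ring
    rw [s1, s2, s3]
    have := mul_le_mul_of_nonneg_left hbud hm.le
    linarith
  -- Telescoping. Both plans enter period 0 with one unit of each asset, so the case T = 0 is an
  -- equality; in the induction step the finite term B ^ T * I T is added to both sides and
  -- cancelled.
  have hsum : ∀ T, ∑ t ∈ Finset.range T, B ^ t * C t + B ^ T * X T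
      ≤ ∑ t ∈ Finset.range T, B ^ t * Y t + B ^ T * I T := by
    intro T
    induction T with
    | zero => simp [hX, hI, portfolioValue, Plan.entering]
    | succ T ih =>
      rw [Finset.sum_range_succ, Finset.sum_range_succ]
      refine (ENNReal.add_le_add_iff_right (hIfin T)).1 ?_
      calc ∑ t ∈ Finset.range T, B ^ t * C t + B ^ T * C T + B ^ (T + 1) * X (T + 1) + B ^ T * I T
          = ∑ t ∈ Finset.range T, B ^ t * C t + B ^ T * (C T + B * X (T + 1) + I T) := by ring
        _ ≤ ∑ t ∈ Finset.range T, B ^ t * C t + B ^ T * (Y T + X T + B * I (T + 1)) := by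
            gcongr _ + _ * ?_; exact hstep T
        _ = (∑ t ∈ Finset.range T, B ^ t * C t + B ^ T * X T)
              + (B ^ T * Y T + B ^ (T + 1) * I (T + 1)) := by ring
        _ ≤ (∑ t ∈ Finset.range T, B ^ t * Y t + B ^ T * I T)
              + (B ^ T * Y T + B ^ (T + 1) * I (T + 1)) := by gcongr
        _ = _ := by ring
  -- Transversality for the unit portfolio. The rival's B ^ T * X T needs no limit: it is
  -- nonnegative and is dropped.
  have hlim : Filter.Tendsto (fun T => B ^ T * I T) Filter.atTop (nhds 0) := by
    refine tendsto_of_tendsto_of_tendsto_of_le_of_le tendsto_const_nhds ?_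
      (fun _ => zero_le) hIle
    have := (tendsto_pow_atTop_nhds_zero_of_lt_one (mul_nonneg hβ hr) hβr).const_mul (k * L * V z₀)
    rw [mul_zero] at this
    simpa using ENNReal.tendsto_ofReal this
  rw [hYutil, hπ.utility_eq_tsum hu hβ Q]
  have h1 : Filter.Tendsto (fun T => ∑ t ∈ Finset.range T, B ^ t * C t) Filter.atTop
      (nhds (∑' t, B ^ t * C t)) := ENNReal.tendsto_nat_tsum _
  have h2 : Filter.Tendsto (fun T => ∑ t ∈ Finset.range T, B ^ t * Y t + B ^ T * I T) Filter.atTop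
      (nhds (∑' t, B ^ t * Y t)) := by
    simpa using (ENNReal.tendsto_nat_tsum fun t => B ^ t * Y t).add hlim
  exact le_of_tendsto_of_tendsto' h1 h2 fun T => le_self_add.trans (hsum T)

/-! ### Transition functions affine in the shock -/

section AffineShock

variable {Q : Kernel Z Z} {ν : Measure (Fin k → ℝ)} {c d : Z → Fin k → ℝ}

theorem measurable_affine_shock (a b : Fin k → ℝ) :
    Measurable fun w : Fin k → ℝ => fun i => a i + b i * w i := by fun_prop

/-- Integration against a transition function driven by the shock map `w ↦ c(z) + d(z) w`. -/
theorem integral_affine_shock (hZm : MeasurableSet Z)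
    (hQ : ∀ z : Z, (Q z).map Subtype.val = ν.map (fun w i => c z i + d z i * w i))
    {f : (Fin k → ℝ) → ℝ} (hf : Measurable f) (z : Z) :
    ∫ z', f (z' : Fin k → ℝ) ∂(Q z) = ∫ w, f (fun i => c z i + d z i * w i) ∂ν := by
  rw [← (MeasurableEmbedding.subtype_coe hZm).integral_map, hQ,
    integral_map (measurable_affine_shock _ _).aemeasurable hf.aestronglyMeasurable]

/-- Dominated convergence along a sequence of states: the convergent coefficients are bounded, so
the affine growth bound yields a majorant integrable in w. -/
theorem continuous_integral_affine_shock [IsProbabilityMeasure ν]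
    (hZm : MeasurableSet Z) (hc : Continuous c) (hd : Continuous d)
    (hw : ∀ᵐ w ∂ν, ∀ i, 0 ≤ w i) (hwi : ∀ i, Integrable (fun w : Fin k → ℝ => w i) ν)
    (hQ : ∀ z : Z, (Q z).map Subtype.val = ν.map (fun w i => c z i + d z i * w i))
    {A : Fin k → ℝ} (hA : ∀ i, 0 ≤ A i) (b : ℝ) {f : Z → ℝ} (hf : Continuous f) {K : ℝ}
    (hK0 : 0 ≤ K) (hK : ∀ z : Z, |f z| ≤ K * (∑ i, A i * (z : Fin k → ℝ) i + b)) :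
    Continuous fun z => ∫ z', f z' ∂(Q z) := by
  -- The extension by 0 is measurable but need not be continuous. Pointwise convergence is therefore
  -- checked inside Z, which almost surely contains all the next-period states involved.
  set g : (Fin k → ℝ) → ℝ := Function.extend Subtype.val f 0 with hg
  have hgz : ∀ z : Z, g z = f z := fun z => Subtype.val_injective.extend_apply f 0 z
  have hgm : Measurable g :=
    (MeasurableEmbedding.subtype_coe hZm).measurable_extend hf.measurable measurable_const
  have hint : ∀ z, ∫ z', f z' ∂(Q z) = ∫ w, g (fun i => c z i + d z i * w i) ∂ν := fun z => by
    rw [← integral_affine_shock hZm hQ hgm z]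
    simp only [hgz]
  have hmem : ∀ z, ∀ᵐ w ∂ν, (fun i => c z i + d z i * w i) ∈ Z := fun z => by
    refine ae_of_ae_map (p := fun x => x ∈ Z) (measurable_affine_shock (c z) (d z)).aemeasurable ?_
    rw [← hQ z, (MeasurableEmbedding.subtype_coe hZm).ae_map_iff]
    exact Filter.Eventually.of_forall fun z' => z'.2
  simp only [hint]
  refine continuous_iff_seqContinuous.2 fun s z hs => ?_
  have hcs : ∀ i, Filter.Tendsto (fun n => c (s n) i) Filter.atTop (nhds (c z i)) := fun i =>
    (((continuous_apply i).comp hc).tendsto z).comp hs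
  have hds : ∀ i, Filter.Tendsto (fun n => d (s n) i) Filter.atTop (nhds (d z i)) := fun i =>
    (((continuous_apply i).comp hd).tendsto z).comp hs
  have hcb : ∀ i, ∃ M, ∀ n, c (s n) i ≤ M := fun i =>
    (hcs i).bddAbove_range.imp fun M hM n => hM ⟨n, rfl⟩
  have hdb : ∀ i, ∃ M, ∀ n, d (s n) i ≤ M := fun i =>
    (hds i).bddAbove_range.imp fun M hM n => hM ⟨n, rfl⟩
  choose M hM using hcb
  choose N hN using hdb
  refine tendsto_integral_of_dominated_convergence
    (fun w => K * (∑ i, A i * (M i + N i * w i) + b))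
    (fun n => (hgm.comp (measurable_affine_shock _ _)).aestronglyMeasurable) ?_ ?_ ?_
  · exact ((integrable_finsetSum _ fun i _ =>
      ((integrable_const _).add ((hwi i).const_mul _)).const_mul _).add
        (integrable_const b)).const_mul K
  · intro n
    filter_upwards [hw, hmem (s n)] with w hw0 hwZ
    have := hK ⟨_, hwZ⟩
    rw [← hgz] at this
    refine this.trans (mul_le_mul_of_nonneg_left ?_ hK0)
    refine add_le_add_left (Finset.sum_le_sum fun i _ => mul_le_mul_of_nonneg_left ?_ (hA i)) b
    exact add_le_add (hM i n) (mul_le_mul_of_nonneg_right (hN i n) (hw0 i))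
  · filter_upwards [hmem z, ae_all_iff.2 fun n => hmem (s n)] with w hz hsn
    have h1 : Filter.Tendsto (fun n => (⟨_, hsn n⟩ : Z)) Filter.atTop (nhds ⟨_, hz⟩) := by
      rw [tendsto_subtype_rng, tendsto_pi_nhds]
      exact fun i => (hcs i).add ((hds i).mul_const _)
    have h2 := (hf.tendsto _).comp h1
    rw [← hgz] at h2
    exact h2.congr fun n => (hgz _).symm

theorem weightedFeller_of_affine_shock [IsProbabilityMeasure ν]
    (hZm : MeasurableSet Z) (hZ : ∀ z ∈ Z, ∀ i, 0 ≤ z i)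
    (hc : Continuous c) (hd : Continuous d)
    (hw : ∀ᵐ w ∂ν, ∀ i, 0 ≤ w i) (hwi : ∀ i, Integrable (fun w : Fin k → ℝ => w i) ν)
    (hQ : ∀ z : Z, (Q z).map Subtype.val = ν.map (fun w i => c z i + d z i * w i))
    {A : Fin k → ℝ} (hA : ∀ i, 0 ≤ A i) {b C r r₀ : ℝ} (hb : 1 ≤ b) (hr : r₀ ≤ r)
    (hCb : C + b ≤ r * b)
    (hdrift : ∀ z : Z, ∑ i, A i * (c z i + d z i * ∫ w, w i ∂ν)
      ≤ r₀ * ∑ i, A i * (z : Fin k → ℝ) i + C) :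
    WeightedFeller Q (fun z => ∑ i, A i * (z : Fin k → ℝ) i + b) r := by
  have hS : ∀ z : Z, 0 ≤ ∑ i, A i * (z : Fin k → ℝ) i := fun z =>
    Finset.sum_nonneg fun i _ => mul_nonneg (hA i) (hZ z z.2 i)
  have hVm : Measurable fun x : Fin k → ℝ => ∑ i, A i * x i + b := by fun_prop
  have hI : ∀ (z : Z) (i : Fin k), Integrable (fun w : Fin k → ℝ => A i * (c z i + d z i * w i)) ν :=
    fun z i => ((integrable_const _).add ((hwi i).const_mul _)).const_mul _
  have hVc : Continuous fun x : Fin k → ℝ => ∑ i, A i * x i + b := by fun_prop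
  refine ⟨hVc.comp continuous_subtype_val, fun z => by linarith [hS z], fun z => ?_, fun z => ?_, fun f hf K hK => ?_⟩
  · have h : Integrable (fun x : Fin k → ℝ => ∑ i, A i * x i + b) ((Q z).map Subtype.val) := by
      rw [hQ z, integrable_map_measure hVm.aestronglyMeasurable
        (measurable_affine_shock _ _).aemeasurable]
      exact (integrable_finsetSum _ fun i _ => hI z i).add (integrable_const b)
    exact (MeasurableEmbedding.subtype_coe hZm).integrable_map_iff.1 h
  · rw [integral_affine_shock hZm hQ hVm z,
      integral_add (integrable_finsetSum _ fun i _ => hI z i) (integrable_const b),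
      integral_finsetSum _ fun i _ => hI z i]
    have h1 : ∀ i, ∫ w : Fin k → ℝ, A i * (c z i + d z i * w i) ∂ν
        = A i * (c z i + d z i * ∫ w, w i ∂ν) := fun i => by
      rw [integral_const_mul, integral_add (integrable_const _) ((hwi i).const_mul _),
        integral_const_mul]
      simp
    simp only [h1, integral_const, probReal_univ, one_smul]
    have := mul_le_mul_of_nonneg_right hr (hS z)
    linarith [hdrift z]
  · refine continuous_integral_affine_shock hZm hc hd hw hwi hQ hA b hf (K := max K 0)
      (le_max_right _ _) fun z => (hK z).trans ?_
    exact mul_le_mul_of_nonneg_right (le_max_left _ _) (by linarith [hS z])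

/-- Under an affine drift condition with rate `r₀ < 1 / β` an affine weight can be chosen. -/
theorem exists_weightedFeller_of_affine_shock [IsProbabilityMeasure ν]
    (hZm : MeasurableSet Z) (hZ : ∀ z ∈ Z, ∀ i, 0 ≤ z i)
    (hc : Continuous c) (hd : Continuous d)
    (hw : ∀ᵐ w ∂ν, ∀ i, 0 ≤ w i) (hwi : ∀ i, Integrable (fun w : Fin k → ℝ => w i) ν)
    (hQ : ∀ z : Z, (Q z).map Subtype.val = ν.map (fun w i => c z i + d z i * w i))
    {A : Fin k → ℝ} (hA : ∀ i, 1 ≤ A i) {β C r₀ : ℝ} (hβ : 0 < β) (hr₀ : 1 ≤ r₀)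
    (hβr : r₀ < 1 / β)
    (hdrift : ∀ z : Z, ∑ i, A i * (c z i + d z i * ∫ w, w i ∂ν)
      ≤ r₀ * ∑ i, A i * (z : Fin k → ℝ) i + C) :
    ∃ (A : Fin k → ℝ) (b r : ℝ), (∀ i, 1 ≤ A i) ∧ 1 ≤ b ∧ 0 ≤ r ∧ β * r < 1 ∧
      WeightedFeller Q (fun z => ∑ i, A i * (z : Fin k → ℝ) i + b) r := by
  obtain ⟨r, hr1, hr2⟩ := exists_between hβr
  have hr3 : 0 < r - 1 := by linarith
  -- This b satisfies C ≤ (r − 1)b, so the additive constant is absorbed; r > r₀ ≥ 1 keeps the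
  -- denominator positive.
  refine ⟨A, max 1 (C / (r - 1)), r, hA, le_max_left _ _, by linarith, ?_,
    weightedFeller_of_affine_shock hZm hZ hc hd hw hwi hQ (fun i => zero_le_one.trans (hA i))
      (le_max_left _ _) hr1.le ?_ hdrift⟩
  · rw [lt_div_iff₀ hβ] at hr2
    linarith
  · have := (div_le_iff₀ hr3).1 (le_max_right 1 (C / (r - 1)))
    linarith

end AffineShock

/-! ### Weights for linear dividends (M1) -/

/-- A linear map that is a strict contraction for some norm has powers tending to zero. -/
theorem tendsto_pow_mulVec_of_seminorm_contraction {B : Matrix (Fin k) (Fin k) ℝ}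
    (N : Seminorm ℝ (Fin k → ℝ)) (hN : ∀ x, N x = 0 → x = 0) {q : ℝ} (hq : q < 1)
    (hB : ∀ x, N (B.mulVec x) ≤ q * N x) (x : Fin k → ℝ) :
    Filter.Tendsto (fun n => (B ^ n).mulVec x) Filter.atTop (nhds 0) := by
  have hcont : Continuous N := N.convexOn.locallyLipschitz.continuous
  -- Equivalence of norms, by minimizing N over the unit sphere. The sphere is empty only in
  -- dimension zero.
  obtain ⟨κ, hκ, hκN⟩ : ∃ κ > 0, ∀ x, κ * ‖x‖ ≤ N x := by
    rcases (Metric.sphere (0 : Fin k → ℝ) 1).eq_empty_or_nonempty with he | hne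
    · refine ⟨1, one_pos, fun x => ?_⟩
      have hx : x = 0 := by
        by_contra hx
        have : ‖x‖⁻¹ • x ∈ Metric.sphere (0 : Fin k → ℝ) 1 := by
          simp [norm_smul, norm_ne_zero_iff.2 hx]
        rw [he] at this
        exact this
      simp [hx]
    · obtain ⟨y, hy, hmin⟩ := (isCompact_sphere (0 : Fin k → ℝ) 1).exists_isMinOn hne
        hcont.continuousOn
      have hy0 : y ≠ 0 := by
        rintro rfl
        simp at hy
      refine ⟨N y, lt_of_le_of_ne (apply_nonneg N y) fun h => hy0 (hN y h.symm), fun x => ?_⟩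
      by_cases hx : x = 0
      · simp [hx]
      have hxn : 0 < ‖x‖ := norm_pos_iff.2 hx
      have hmem : ‖x‖⁻¹ • x ∈ Metric.sphere (0 : Fin k → ℝ) 1 := by
        simp [norm_smul, hxn.ne']
      have h := isMinOn_iff.1 hmin _ hmem
      rw [map_smul_eq_mul, Real.norm_of_nonneg (inv_nonneg.2 hxn.le), inv_mul_eq_div,
        le_div_iff₀ hxn] at h
      exact h
  -- A negative q is possible only in dimension zero; the truncation makes the powers monotone in
  -- the induction.
  set q' := max q 0 with hq'
  have hpow : ∀ n, N ((B ^ n).mulVec x) ≤ q' ^ n * N x := by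
    intro n
    induction n with
    | zero => simp
    | succ n ih =>
      rw [pow_succ', ← Matrix.mulVec_mulVec, pow_succ', mul_assoc]
      refine (hB _).trans ?_
      exact mul_le_mul (le_max_left _ _) ih (apply_nonneg _ _) (le_max_right _ _)
  rw [tendsto_zero_iff_norm_tendsto_zero]
  have hlim : Filter.Tendsto (fun n => q' ^ n * N x / κ) Filter.atTop (nhds 0) := by
    have := ((tendsto_pow_atTop_nhds_zero_of_lt_one (le_max_right q 0)
      (max_lt hq one_pos)).mul_const (N x)).div_const κ
    simpa using this
  refine squeeze_zero (fun n => norm_nonneg _) (fun n => ?_) hlim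
  rw [le_div_iff₀ hκ, mul_comm]
  exact (hκN _).trans (hpow n)

/-- A nonnegative matrix that contracts some norm admits a weight vector `A ≥ 1` with
`Aᵀ B ≤ Aᵀ`. -/
theorem exists_weight_of_seminorm_contraction {B : Matrix (Fin k) (Fin k) ℝ}
    (hB0 : ∀ i j, 0 ≤ B i j)
    (N : Seminorm ℝ (Fin k → ℝ)) (hN : ∀ x, N x = 0 → x = 0) {q : ℝ} (hq : q < 1)
    (hB : ∀ x, N (B.mulVec x) ≤ q * N x) :
    ∃ A : Fin k → ℝ, (∀ i, 1 ≤ A i) ∧ ∀ j, ∑ i, A i * B i j ≤ A j := by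
  have hlim : ∀ i j, Filter.Tendsto (fun n => (B ^ n) i j) Filter.atTop (nhds 0) := fun i j => by
    have h := tendsto_pi_nhds.1
      (tendsto_pow_mulVec_of_seminorm_contraction N hN hq hB (Pi.single j 1)) i
    simpa using h
  have hcol : ∀ j, Filter.Tendsto (fun n => ∑ i, (B ^ n) i j) Filter.atTop (nhds 0) := fun j => by
    simpa using tendsto_finsetSum Finset.univ fun i _ => hlim i j
  have hev : ∀ᶠ n in Filter.atTop, ∀ j, ∑ i, (B ^ n) i j ≤ 1 :=
    Filter.eventually_all.2 fun j => (hcol j).eventually_le_const one_pos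
  obtain ⟨m, hm1, hm0⟩ := (hev.and (Filter.eventually_ge_atTop 1)).exists
  have hpow : ∀ n i j, 0 ≤ (B ^ n) i j := by
    intro n
    induction n with
    | zero => intro i j; rw [pow_zero, Matrix.one_apply]; split_ifs <;> norm_num
    | succ n ih =>
      intro i j
      rw [pow_succ, Matrix.mul_apply]
      exact Finset.sum_nonneg fun l _ => mul_nonneg (ih i l) (hB0 l j)
  have hzero : ∀ j, ∑ i, (B ^ 0) i j = 1 := fun j => by simp [Matrix.one_apply]
  -- Take Aᵀ = ∑_{n<m} 𝟏ᵀBⁿ. The term n = 0 gives A ≥ 1, and AᵀB = Aᵀ − 𝟏ᵀ + 𝟏ᵀBᵐ ≤ Aᵀ because the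
  -- column sums of Bᵐ are at most 1.
  refine ⟨fun j => ∑ n ∈ Finset.range m, ∑ i, (B ^ n) i j, fun j => ?_, fun j => ?_⟩
  · rw [← hzero j]
    exact Finset.single_le_sum (f := fun n => ∑ i, (B ^ n) i j)
      (fun n _ => Finset.sum_nonneg fun i _ => hpow n i j) (Finset.mem_range.2 hm0)
  · have h1 : ∑ i, (∑ n ∈ Finset.range m, ∑ l, (B ^ n) l i) * B i j
        = ∑ n ∈ Finset.range m, ∑ l, (B ^ (n + 1)) l j := by
      simp only [Finset.sum_mul, pow_succ, Matrix.mul_apply]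
      rw [Finset.sum_comm]
      exact Finset.sum_congr rfl fun n _ => Finset.sum_comm
    have h2 := Finset.sum_range_succ (fun n => ∑ l, (B ^ n) l j) m
    rw [Finset.sum_range_succ', hzero] at h2
    rw [h1]
    linarith [hm1 j]

theorem LinearDividends.exists_weightedFeller {Q : Kernel Z Z} (hQ : LinearDividends Q)
    (hZm : MeasurableSet Z) (hZ : ∀ z ∈ Z, ∀ i, 0 ≤ z i) {β : ℝ} (hβ : 0 < β)
    (hβ1 : β < 1) :
    ∃ (A : Fin k → ℝ) (b r : ℝ), (∀ i, 1 ≤ A i) ∧ 1 ≤ b ∧ 0 ≤ r ∧ β * r < 1 ∧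
      WeightedFeller Q (fun z => ∑ i, A i * (z : Fin k → ℝ) i + b) r := by
  obtain ⟨B, ν, hν, hB0, ⟨N, hN, q, hq, hB⟩, hw, hwi, hmap⟩ := hQ
  obtain ⟨A, hA, hAB⟩ := exists_weight_of_seminorm_contraction hB0 N hN hq hB
  refine exists_weightedFeller_of_affine_shock (c := fun z => B.mulVec (z : Fin k → ℝ))
    (d := fun _ _ => 1) (C := ∑ i, A i * ∫ w, w i ∂ν) hZm hZ ?_ continuous_const hw hwi
    (fun z => ?_) hA hβ le_rfl ?_ fun z => ?_
  · exact Continuous.matrix_mulVec continuous_const continuous_subtype_val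
  · rw [hmap z]
    congr 1
    funext w i
    simp
  · rwa [lt_div_iff₀ hβ, one_mul]
  · simp only [one_mul, mul_add, Finset.sum_add_distrib]
    refine add_le_add_left ?_ _
    simp only [Matrix.mulVec, dotProduct, Finset.mul_sum]
    rw [Finset.sum_comm]
    refine Finset.sum_le_sum fun j _ => ?_
    have := mul_le_mul_of_nonneg_right (hAB j) (hZ z z.2 j)
    rw [Finset.sum_mul] at this
    simpa only [mul_assoc] using this

/-! ### Weights for log-linear dividends (M2) -/

/-- A power with exponent `ρ < 1` is dominated by an arbitrarily flat affine function. -/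
theorem exists_rpow_le_affine {ρ : ℝ} (hρ0 : 0 ≤ ρ) (hρ : ρ < 1) {ε : ℝ} (hε : 0 < ε) :
    ∃ C : ℝ, 0 ≤ C ∧ ∀ x : ℝ, 0 ≤ x → x ^ ρ ≤ ε * x + C := by
  -- Beyond M the factor x^(ρ−1) is at most ε, so x^ρ ≤ εx; below M the constant M^ρ suffices.
  have hlim := tendsto_rpow_neg_atTop (sub_pos.2 hρ)
  obtain ⟨M, hM, hM1⟩ :=
    ((hlim.eventually_le_const hε).and (Filter.eventually_ge_atTop 1)).exists
  have hM0 : 0 < M := by linarith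
  refine ⟨M ^ ρ, by positivity, fun x hx => ?_⟩
  rcases le_total x M with h | h
  · have := Real.rpow_le_rpow hx h hρ0
    nlinarith [mul_nonneg hε.le hx]
  · have hx0 : 0 < x := hM0.trans_le h
    have h1 : x ^ ρ = x ^ (-(1 - ρ)) * x := by
      nth_rewrite 3 [← Real.rpow_one x]
      rw [← Real.rpow_add hx0]
      congr 1; ring
    have h2 : x ^ (-(1 - ρ)) ≤ ε :=
      (Real.rpow_le_rpow_of_nonpos hM0 h (by linarith)).trans hM
    rw [h1]
    have h3 : 0 ≤ M ^ ρ := by positivity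
    nlinarith

theorem LogLinearDividends.exists_weightedFeller {Q : Kernel Z Z} {β : ℝ}
    (hQ : LogLinearDividends β Q)
    (hZm : MeasurableSet Z) (hZ : ∀ z ∈ Z, ∀ i, 0 ≤ z i) (hβ : 0 < β)
    (hβ1 : β < 1) :
    ∃ (A : Fin k → ℝ) (b r : ℝ), (∀ i, 1 ≤ A i) ∧ 1 ≤ b ∧ 0 ≤ r ∧ β * r < 1 ∧
      WeightedFeller Q (fun z => ∑ i, A i * (z : Fin k → ℝ) i + b) r := by
  obtain ⟨ρ, ν, hν, hρ, hw, hwi, hm, hmap⟩ := hQ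
  have hβ' : 1 < 1 / β := by rwa [lt_div_iff₀ hβ, one_mul]
  -- Finitely many strict inequalities below 1/β leave room for a common r₀ just to its left.
  obtain ⟨r₀, ⟨h1r, hrm⟩, hrβ⟩ : ∃ r₀ : ℝ, (1 ≤ r₀ ∧ ∀ i, ρ i = 1 → ∫ w, w i ∂ν ≤ r₀) ∧
      r₀ < 1 / β := by
    have e1 : ∀ᶠ r in nhdsWithin (1 / β) (Iio (1 / β)),
        1 ≤ r ∧ ∀ i, ρ i = 1 → ∫ w, w i ∂ν ≤ r := by
      refine ((eventually_ge_nhds hβ').filter_mono nhdsWithin_le_nhds).and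
        (Filter.eventually_all.2 fun i => ?_)
      by_cases h : ρ i = 1
      · exact ((eventually_ge_nhds (hm i h)).filter_mono nhdsWithin_le_nhds).mono fun r hr _ => hr
      · exact Filter.Eventually.of_forall fun r h' => absurd h' h
    exact (e1.and self_mem_nhdsWithin).exists
  have hm1 : ∀ i, 1 ≤ ∫ w, w i ∂ν := fun i => by
    have := integral_mono_ae (integrable_const (1 : ℝ)) (hwi i) (hw.mono fun w h => h i)
    simpa using this
  have hC : ∀ i, ∃ C : ℝ, ∀ x : ℝ, 0 ≤ x → x ^ ρ i * ∫ w, w i ∂ν ≤ r₀ * x + C := fun i => by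
    have hmi := zero_lt_one.trans_le (hm1 i)
    rcases (hρ i).2.eq_or_lt with h | h
    · refine ⟨0, fun x hx => ?_⟩
      rw [h, Real.rpow_one, add_zero, mul_comm]
      exact mul_le_mul_of_nonneg_right (hrm i h) hx
    · obtain ⟨C, -, hC⟩ := exists_rpow_le_affine (hρ i).1 h (inv_pos.2 hmi)
      refine ⟨C * ∫ w, w i ∂ν, fun x hx => ?_⟩
      refine (mul_le_mul_of_nonneg_right (hC x hx) hmi.le).trans ?_
      rw [add_mul, mul_assoc, mul_comm x, ← mul_assoc, inv_mul_cancel₀ hmi.ne']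
      gcongr
  choose C hC using hC
  refine exists_weightedFeller_of_affine_shock (c := fun _ _ => 0)
    (d := fun z i => (z : Fin k → ℝ) i ^ ρ i) (A := fun _ => 1) (C := ∑ i, C i) hZm hZ
    continuous_const ?_ (hw.mono fun w h i => zero_le_one.trans (h i)) hwi (fun z => ?_)
    (fun _ => le_rfl) hβ h1r hrβ fun z => ?_
  · exact continuous_pi fun i => ((continuous_apply i).comp continuous_subtype_val).rpow_const
      fun z => Or.inr (hρ i).1
  · simp only [hmap z, zero_add]
  · simp only [one_mul, zero_add]
    rw [Finset.mul_sum, ← Finset.sum_add_distrib]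
    exact Finset.sum_le_sum fun i _ => hC i _ (hZ z z.2 i)

end Lucas

/-! ### Assembly of the equilibrium -/

theorem theorem7 {k : ℕ} (Z : Set (Fin k → ℝ)) (hZm : MeasurableSet Z)
    (hZ : ∀ z ∈ Z, ∀ i, 0 ≤ z i)
    (β : ℝ) (hβ : β ∈ Set.Ioo (0 : ℝ) 1)
    (u : ℝ → ℝ) (hu0 : u 0 = 0)
    (hu1 : ContDiffOn ℝ 1 u (Set.Ici 0))
    (hu2 : ∀ c, 0 ≤ c → 0 < Lucas.marginal u c)
    (hu3 : StrictConcaveOn ℝ (Set.Ici 0) u)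
    (γ δ : ℝ) (hγ : 0 ≤ γ) (hδ : 0 ≤ δ)
    (hu4 : ∀ c, 0 ≤ c → c * Lucas.marginal u c ≤ γ * c + δ)
    (a : ℝ) (ha : 0 < a)
    (hu5 : ∀ z ∈ Z, a ≤ Lucas.marginal u (Lucas.total z))
    (Q : ProbabilityTheory.Kernel Z Z) [ProbabilityTheory.IsMarkovKernel Q]
    (hQ : Lucas.LinearDividends Q ∨ Lucas.LogLinearDividends β Q) :
    ∃ (φ : Fin k → Z → ℝ) (p : Z → Fin k → ℝ),
      Lucas.SolvesLucas β u Q φ ∧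
      (∀ z i, p z i = φ i z / Lucas.marginal u (Lucas.total (z : Fin k → ℝ))) ∧
      Lucas.IsEquilibriumPrice β u Q p ∧
      ∃ (A : Fin k → Fin k → ℝ) (b : Fin k → ℝ),
        (∀ i j, 0 ≤ A i j) ∧ (∀ i, 0 < b i) ∧
        ∀ (z : Z) i, p z i ≤ ∑ j, A i j * (z : Fin k → ℝ) j + b i := by
  have htot : ∀ z : Z, 0 ≤ Lucas.total (z : Fin k → ℝ) := fun z => Lucas.total_nonneg (hZ z z.2)
  have hMpos : ∀ z : Z, 0 < Lucas.marginal u (Lucas.total (z : Fin k → ℝ)) := fun z =>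
    hu2 _ (htot z)
  have hMc : Continuous fun z : Z => Lucas.marginal u (Lucas.total (z : Fin k → ℝ)) :=
    (hu1.continuousOn_derivWithin (uniqueDiffOn_Ici 0) le_rfl).comp_continuous
      (Lucas.continuous_total.comp continuous_subtype_val) htot
  obtain ⟨A, b, r, hA, hb, hr, hβr, hV⟩ : ∃ (A : Fin k → ℝ) (b r : ℝ), (∀ i, 1 ≤ A i) ∧ 1 ≤ b ∧
      0 ≤ r ∧ β * r < 1 ∧
      Lucas.WeightedFeller Q (fun z => ∑ i, A i * (z : Fin k → ℝ) i + b) r :=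
    hQ.elim (fun h => h.exists_weightedFeller hZm hZ hβ.1 hβ.2)
      (fun h => h.exists_weightedFeller hZm hZ hβ.1 hβ.2)
  set V : Z → ℝ := fun z => ∑ i, A i * (z : Fin k → ℝ) i + b with hVdef
  have htV : ∀ z : Z, Lucas.total (z : Fin k → ℝ) ≤ V z := fun z => by
    have : Lucas.total (z : Fin k → ℝ) ≤ ∑ i, A i * (z : Fin k → ℝ) i :=
      Finset.sum_le_sum fun i _ => le_mul_of_one_le_left (hZ z z.2 i) (hA i)
    simp only [hVdef]
    linarith
  set g : Fin k → Z → ℝ := fun i z =>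
    (z : Fin k → ℝ) i * Lucas.marginal u (Lucas.total (z : Fin k → ℝ)) with hg
  have hgc : ∀ i, Continuous (g i) := fun i =>
    ((continuous_apply i).comp continuous_subtype_val).mul hMc
  have hg0 : ∀ i z, 0 ≤ g i z := fun i z => mul_nonneg (hZ z z.2 i) (hMpos z).le
  -- z_i u'(𝟏ᵀz) ≤ 𝟏ᵀz u'(𝟏ᵀz) ≤ γ𝟏ᵀz + δ, and both 𝟏ᵀz and 1 are at most V.
  have hgK : ∀ i z, g i z ≤ (γ + δ) * V z := fun i z => by
    have h1 : (z : Fin k → ℝ) i ≤ Lucas.total (z : Fin k → ℝ) :=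
      Finset.single_le_sum (f := fun i => (z : Fin k → ℝ) i) (fun j _ => hZ z z.2 j)
        (Finset.mem_univ i)
    have h2 := mul_le_mul_of_nonneg_right h1 (hMpos z).le
    have h3 := hu4 _ (htot z)
    have h4 := mul_le_mul_of_nonneg_left (htV z) hγ
    have h5 := mul_le_mul_of_nonneg_left (hV.one_le z) hδ
    simp only [hg]
    linarith
  have hgi : ∀ i z, Integrable (g i) (Q z) := fun i z =>
    hV.integrable (hgc i) (fun z => by rw [abs_of_nonneg (hg0 i z)]; exact hgK i z) z
  choose φ L hL0 hφc hφ0 hφL hφ using fun i =>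
    hV.exists_solution hr hβ.1.le hβr (hgc i) (hg0 i) (add_nonneg hγ hδ) (hgK i)
  have hφi : ∀ i z, Integrable (φ i) (Q z) := fun i z =>
    hV.integrable (hφc i) (fun z => by rw [abs_of_nonneg (hφ0 i z)]; exact hφL i z) z
  -- The coefficients come from p_i ≤ L_i V / a; the added 1 keeps the constant positive even if L_i
  -- = 0.
  refine ⟨φ, fun z i => φ i z / Lucas.marginal u (Lucas.total (z : Fin k → ℝ)),
    fun i z => ⟨hgi i z, hφi i z, hφ i z⟩, fun _ _ => rfl, ⟨?_, ?_, fun z₀ => ?_⟩,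
    fun i j => L i / a * A j, fun i => L i / a * b + 1, fun i j => ?_, fun i => ?_, fun z i => ?_⟩
  · exact continuous_pi fun i => (hφc i).div hMc fun z => (hMpos z).ne'
  · exact fun z i => div_nonneg (hφ0 i z) (hMpos z).le
  · have hLsum : ∀ i, L i ≤ ∑ j, L j := fun i =>
      Finset.single_le_sum (fun j _ => hL0 j) (Finset.mem_univ i)
    refine Lucas.clearingPlan_optimal hV hr hβ.1.le hβr hZ hu0 hu1.continuousOn hu2
      (fun c y hc hy => Lucas.le_tangent_of_concaveOn (hu1.differentiableOn one_ne_zero)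
        hu3.concaveOn hc hy) zero_le_one (fun z => by simpa using htV z)
      (ψ := fun i z => g i z + φ i z) (φ := φ) (fun i => (hgc i).add (hφc i))
      (L := (γ + δ) + ∑ j, L j)
      (add_nonneg (add_nonneg hγ hδ) (Finset.sum_nonneg fun j _ => hL0 j)) (fun i z => ?_) hφ0
      (fun i z => ?_) (fun _ _ => rfl) (fun z i => ?_) z₀
    · have := mul_le_mul_of_nonneg_right (hLsum i) (hV.weight_nonneg z)
      rw [add_mul]
      exact add_le_add (hgK i z) ((hφL i z).trans this)
    · rw [integral_add (hgi i z) (hφi i z), mul_add]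
      exact hφ i z
    · exact (div_mul_cancel₀ _ (hMpos z).ne').symm
  · exact mul_nonneg (div_nonneg (hL0 i) ha.le) (zero_le_one.trans (hA j))
  · have := mul_nonneg (div_nonneg (hL0 i) ha.le) (zero_le_one.trans hb)
    linarith
  · calc φ i z / Lucas.marginal u (Lucas.total (z : Fin k → ℝ)) ≤ φ i z / a :=
          div_le_div_of_nonneg_left (hφ0 i z) ha (hu5 z z.2)
      _ ≤ L i * V z / a := div_le_div_of_nonneg_right (hφL i z) ha.le
      _ = ∑ j, L i / a * A j * (z : Fin k → ℝ) j + L i / a * b := by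
          simp only [hVdef, mul_assoc]
          rw [← Finset.mul_sum]
          ring
      _ ≤ _ := by linarith
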